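/- Let $n\ge 1$ and let $X_1,\dots,X_n,Y_1,\dots,Y_n$ (net losses) and $\Theta_1,\dots,\Theta_n,\Delta_1,\dots,\Delta_n$ (discount factors) be real random variables on one probability space. Write $F_i,G_i$ for the distributions of $X_i,Y_i$, $\overline F_i(x)=P(X_i>x)$, $\overline G_i(y)=P(Y_i>y)$, $x\wedge y=\min\{x,y\}$, $z^-=\max\{-z,0\}$, and $$X_k(\Theta)=\sum_{i=1}^k\Theta_iX_i,\qquad Y_k(\Delta)=\sum_{j=1}^k\Delta_jY_j,\qquad \psi(x,y,n)=P\Big(\max_{1\le k\le n}X_k(\Theta)>x,\ \max_{1\le k\le n}Y_k(\Delta)>y\Big).$$ Here $f(x,y)\sim g(x,y)$ as $x\wedge y\to\infty$ means $f-g=o(g)$, i.e. $f/g\to1$ whenever $g$ is eventually non-zero. Assume: 1. (Generalized tail asymptotic independence) For all $1\le i\ne k\le n$ and $1\le j\le n$, $$\lim_{x_i\wedge x_k\wedge y_j\to\infty}P(|X_i|>x_i\mid X_k>x_k,\,Y_j>y_j)=0,$$ and for all $1\le j\ne k\le n$ and $1\le i\le n$, $$\lim_{x_i\wedge y_j\wedge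 y_k\to\infty}P(|Y_j|>y_j\mid X_i>x_i,\,Y_k>y_k)=0 .$$ 2. Each $\Theta_i$ and each $\Delta_j$ is almost surely non-negative and bounded from above, with $P(\Theta_i>0)>0$ and $P(\Delta_j>0)>0$. The vector $(\Theta_1,\dots,\Theta_n,\Delta_1,\dots,\Delta_n)$, whose components may be arbitrarily dependent, is independent of $(X_1,\dots,X_n,Y_1,\dots,Y_n)$. 3. Every $V\in\{F_1,\dots,F_n,G_1,\dots,G_n\}$ satisfies $\overline V(x)>0$ for all $x$, is long-tailed, $\lim_{x\to\infty}\overline V(x-a)/\overline V(x)=1$ for all $a>0$, and is dominatedly varying, $\limsup_{x\to\infty}\overline V(tx)/\overline V(x)<\infty$ for all $0<t<1$. 4. (Strong asymptotic independence) For each $i$ there is a constant $C_i>0$ such that, as $x\wedge y\to\infty$, $P(X_i>x,Y_i>y)\sim C_i\overline F_i(x)\overline G_i(y)$, $P(X_i^->x,Y_i>y)=O(F_i(-x)\overline G_i(y))$ and $P(X_i>x,Y_i^->y)=O(\overline F_i(x)G_i(-y))$. For $i\ne j$, $X_i$ and $Y_j$ are independent. Then: (i) As $x\wedge y\to\infty$,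 $$\psi(x,y,n)\sim\sum_{i=1}^n\sum_{j=1}^nP(\Theta_iX_i>x,\ \Delta_jY_j>y).$$ (ii) If in addition there are $\alpha_i,\alpha'_j\in[0,\infty)$ such that $\lim_{x\to\infty}\overline F_i(tx)/\overline F_i(x)=t^{-\alpha_i}$ and $\lim_{x\to\infty}\overline G_j(tx)/\overline G_j(x)=t^{-\alpha'_j}$ for all $t>0$ and all $1\le i,j\le n$, then, as $x\wedge y\to\infty$, $$\psi(x,y,n)\sim P\big(X_n(\Theta)>x,\ Y_n(\Delta)>y\big)\sim\sum_{i=1}^n\sum_{\substack{j=1\\ j\ne i}}^nE\big[\Theta_i^{\alpha_i}\Delta_j^{\alpha'_j}\big]\overline F_i(x)\overline G_j(y)+\sum_{i=1}^nC_i\,E\big[\Theta_i^{\alpha_i}\Delta_i^{\alpha'_i}\big]\overline F_i(x)\overline G_i(y),$$ where $0^0$ is read as $0$ in the expectations (that is, $\Theta_i^{0}=\mathbf 1_{\{\Theta_i>0\}}$ and $\Delta_j^{0}=\mathbf 1_{\{\Delta_j>0\}}$). -/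

import Mathlib

open MeasureTheory ProbabilityTheory Filter Topology Asymptotics

namespace BivariateRisk

noncomputable section

/-- The tail `V̄(x) = V((x, ∞))` of a distribution `V` on the real line. -/
def tail (V : Measure ℝ) (x : ℝ) : ℝ := V.real (Set.Ioi x)

/-- Infinite right endpoint: the tail never vanishes. -/
def UnboundedAbove (V : Measure ℝ) : Prop := ∀ x : ℝ, 0 < tail V x

/-- The class `𝓛` of long-tailed distributions. -/
def LongTailed (V : Measure ℝ) : Prop :=
  UnboundedAbove V ∧
    ∀ a : ℝ, 0 < a → Tendsto (fun x => tail V (x - a) / tail V x) atTop (𝓝 1)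

/-- The class `𝓓` of dominatedly varying distributions:
`limsup V̄(t x) / V̄(x) < ∞` for all `0 < t < 1`. -/
def DominatedlyVarying (V : Measure ℝ) : Prop :=
  UnboundedAbove V ∧
    ∀ t : ℝ, 0 < t → t < 1 → (fun x => tail V (t * x)) =O[atTop] (fun x => tail V x)

/-- The class `𝓡_{-a}` of regularly varying distributions (slowly varying for `a = 0`). -/
def RegularlyVarying (V : Measure ℝ) (a : ℝ) : Prop :=
  UnboundedAbove V ∧
    ∀ t : ℝ, 0 < t → Tendsto (fun x => tail V (t * x) / tail V x) atTop (𝓝 (t ^ (-a)))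

variable {Ω : Type*} [MeasurableSpace Ω]

/-- Strong asymptotic independence of `X` and `Y` with constant `C > 0`.  The limit
`x ∧ y → ∞` is the filter `atTop ×ˢ atTop`; `F(-x) = P(X ≤ -x)`, and `max (-t) 0` is the
negative part of `t`. -/
structure SAI (μ : Measure Ω) (X Y : Ω → ℝ) (C : ℝ) : Prop where
  pos : 0 < C
  neg_left :
    (fun p : ℝ × ℝ => μ.real {ω | p.1 < max (-X ω) 0 ∧ p.2 < Y ω}) =O[atTop ×ˢ atTop]
      (fun p => μ.real {ω | X ω ≤ -p.1} * μ.real {ω | p.2 < Y ω})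
  neg_right :
    (fun p : ℝ × ℝ => μ.real {ω | p.1 < X ω ∧ p.2 < max (-Y ω) 0}) =O[atTop ×ˢ atTop]
      (fun p => μ.real {ω | p.1 < X ω} * μ.real {ω | Y ω ≤ -p.2})
  tails :
    Tendsto (fun p : ℝ × ℝ => μ.real {ω | p.1 < X ω ∧ p.2 < Y ω} /
        (μ.real {ω | p.1 < X ω} * μ.real {ω | p.2 < Y ω}))
      (atTop ×ˢ atTop) (𝓝 C)

/-- Generalized tail asymptotic independence of `X 1, …, X n, Y 1, …, Y m`.  In each limit the
variable `p` collects the three thresholds, which tend to infinity jointly. -/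
structure GTAI (μ : Measure Ω) (n m : ℕ) (X Y : ℕ → Ω → ℝ) : Prop where
  left : ∀ i ∈ Finset.Icc 1 n, ∀ k ∈ Finset.Icc 1 n, k ≠ i → ∀ j ∈ Finset.Icc 1 m,
    Tendsto (fun p : ℝ × ℝ × ℝ =>
        (cond μ {ω | p.2.1 < X k ω ∧ p.2.2 < Y j ω}).real {ω | p.1 < |X i ω|})
      (atTop ×ˢ atTop ×ˢ atTop) (𝓝 0)
  right : ∀ j ∈ Finset.Icc 1 m, ∀ k ∈ Finset.Icc 1 m, j ≠ k → ∀ i ∈ Finset.Icc 1 n,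
    Tendsto (fun p : ℝ × ℝ × ℝ =>
        (cond μ {ω | p.2.1 < X i ω ∧ p.2.2 < Y k ω}).real {ω | p.1 < |Y j ω|})
      (atTop ×ˢ atTop ×ˢ atTop) (𝓝 0)

/-- A random weight: non-negative, not degenerate at zero, with support bounded from above. -/
structure IsWeight (μ : Measure Ω) (T : Ω → ℝ) : Prop where
  measurable : Measurable T
  nonneg : ∀ᵐ ω ∂μ, 0 ≤ T ω
  nondegenerate : 0 < μ {ω | 0 < T ω}
  bounded : ∃ b : ℝ, ∀ᵐ ω ∂μ, T ω ≤ b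

/-- Net losses `X i, Y i` and discount factors `Θ i, Δ i` over the periods `1, …, n`: the losses
are GTAI with marginals in `𝓓 ∩ 𝓛`, each pair `(X i, Y i)` is SAI with constant `C i`, `X i` and
`Y j` are independent for `i ≠ j`, and the weights, arbitrarily dependent among themselves, are
jointly independent of the losses. -/
structure Model (μ : Measure Ω) (n : ℕ) (Θ Δ X Y : ℕ → Ω → ℝ) (C : ℕ → ℝ) : Prop where
  measurable_X : ∀ i ∈ Finset.Icc 1 n, Measurable (X i)
  measurable_Y : ∀ i ∈ Finset.Icc 1 n, Measurable (Y i)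
  gtai : GTAI μ n n X Y
  weight_left : ∀ i ∈ Finset.Icc 1 n, IsWeight μ (Θ i)
  weight_right : ∀ i ∈ Finset.Icc 1 n, IsWeight μ (Δ i)
  indep_weights : IndepFun (fun ω (i : Finset.Icc 1 n) => (Θ i ω, Δ i ω))
    (fun ω (i : Finset.Icc 1 n) => (X i ω, Y i ω)) μ
  class_X : ∀ i ∈ Finset.Icc 1 n, DominatedlyVarying (μ.map (X i)) ∧ LongTailed (μ.map (X i))
  class_Y : ∀ i ∈ Finset.Icc 1 n, DominatedlyVarying (μ.map (Y i)) ∧ LongTailed (μ.map (Y i))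
  sai : ∀ i ∈ Finset.Icc 1 n, SAI μ (X i) (Y i) (C i)
  indep : ∀ i ∈ Finset.Icc 1 n, ∀ j ∈ Finset.Icc 1 n, i ≠ j → IndepFun (X i) (Y j) μ

/-- The randomly weighted sum `W 1 * Z 1 + ⋯ + W k * Z k`. -/
def wsum (W Z : ℕ → Ω → ℝ) (k : ℕ) (ω : Ω) : ℝ := ∑ i ∈ Finset.Icc 1 k, W i ω * Z i ω

/-- The maximum of the randomly weighted sums over `1 ≤ k ≤ n`. -/
def maxSum (W Z : ℕ → Ω → ℝ) (n : ℕ) (hn : 1 ≤ n) (ω : Ω) : ℝ :=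
  (Finset.Icc 1 n).sup' (Finset.nonempty_Icc.2 hn) (fun k => wsum W Z k ω)

/-- The ruin probability `ψ(x, y, n)`. -/
def ruinProb (μ : Measure Ω) (Θ Δ X Y : ℕ → Ω → ℝ) (n : ℕ) (hn : 1 ≤ n) (x y : ℝ) : ℝ :=
  μ.real {ω | x < maxSum Θ X n hn ω ∧ y < maxSum Δ Y n hn ω}

/-- The power `t ^ a` of a non-negative number, with `0 ^ a = 0` for every `a ≥ 0`.  This differs
from the real power only at `a = t = 0`. -/
def zpowr (t a : ℝ) : ℝ := if 0 < t then t ^ a else 0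

/-- The mixed moment `E[S ^ a * T ^ b]` of two non-negative weights. -/
def mixedMoment (μ : Measure Ω) (S T : Ω → ℝ) (a b : ℝ) : ℝ :=
  ∫ ω, zpowr (S ω) a * zpowr (T ω) b ∂μ

end

end BivariateRisk

open BivariateRisk

namespace BivariateRisk

/-! ### Tails of distributions -/

/-! The principle is a single big jump in each coordinate: both sums are large essentially because
one `Θ i * X i` and one `Δ j * Y j` are large while all other summands stay bounded.

For one pair, freeze the independent weights at `a`, `d`: the joint tail becomes that of the losses
at `(x / a, y / d)`, comparable to the product of marginal tails. Dominated variation and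
boundedness of the weights give a majorant uniform in the weights, so dominated convergence carries
long-tailedness (`isLittleO_weighted_sub`) and regular variation
(`tendsto_weighted_of_regularlyVarying`) over to the weighted pair. The product of marginal tails is
in turn dominated by the weighted joint tail unless the two weights are almost surely never positive
together, in which case that tail eventually vanishes (`isBigO_prodTail_weighted`,
`weighted_eq_zero`).

For the sums, fix a large constant `L`. If some partial sums exceed `x` and `y`, then either one
summand of each family exceeds its threshold minus `n * L`, or two moderately large summands occur
together with a third above `L`; tail asymptotic independence makes the latter negligible.
Conversely, the events that `a i` and `b j` exceed `x + n * L` and `y + n * L` and all others are at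
most `L` are disjoint and force both full sums to be large. Shift insensitivity removes `n * L`, and
the ruin probability and the tail of the full sums are caught in one sandwich
(`SingleJump.isEquivalent_of_between`). -/

lemma tail_map {Ω : Type*} [MeasurableSpace Ω] {μ : Measure Ω} {V : Ω → ℝ} (hV : Measurable V)
    (x : ℝ) : tail (μ.map V) x = μ.real {ω | x < V ω} := by
  rw [tail, map_measureReal_apply hV measurableSet_Ioi]
  rfl

lemma tail_nonneg (V : Measure ℝ) (x : ℝ) : 0 ≤ tail V x := measureReal_nonneg

lemma tail_antitone (V : Measure ℝ) [IsFiniteMeasure V] : Antitone (tail V) :=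
  fun _ _ h => measureReal_mono (Set.Ioi_subset_Ioi h)

lemma DominatedlyVarying.isBigO_tail_mul {V : Measure ℝ} [IsFiniteMeasure V]
    (hV : DominatedlyVarying V) {s : ℝ} (hs : 0 < s) :
    (fun x => tail V (s * x)) =O[atTop] (fun x => tail V x) := by
  rcases lt_or_ge s 1 with h | h
  · exact hV.2 s hs h
  · refine IsBigO.of_bound 1 ?_
    filter_upwards [eventually_ge_atTop 0] with x hx
    rw [Real.norm_of_nonneg (tail_nonneg _ _), Real.norm_of_nonneg (tail_nonneg _ _), one_mul]
    exact tail_antitone V (by nlinarith)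

lemma DominatedlyVarying.isBigO_tail {V : Measure ℝ} [IsFiniteMeasure V]
    (hV : DominatedlyVarying V) {s : ℝ} (hs : 0 < s) :
    (fun x => tail V x) =O[atTop] (fun x => tail V (s * x)) := by
  have h := (hV.isBigO_tail_mul (inv_pos.2 hs)).comp_tendsto
    (Tendsto.const_mul_atTop hs tendsto_id)
  refine h.congr_left fun x => ?_
  simp [inv_mul_cancel_left₀ hs.ne']

lemma LongTailed.isEquivalent_sub {V : Measure ℝ} (hV : LongTailed V) (a : ℝ) :
    (fun x => tail V (x - a)) ~[atTop] (fun x => tail V x) := by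
  have key : ∀ a : ℝ, 0 < a → (fun x => tail V (x - a)) ~[atTop] (fun x => tail V x) :=
    fun a ha => isEquivalent_of_tendsto_one (hV.2 a ha)
  rcases lt_trichotomy a 0 with h | rfl | h
  · have h' := ((key (-a) (by linarith)).comp_tendsto
      (tendsto_atTop_add_const_right atTop (-a) tendsto_id)).symm
    refine (h'.congr_left ?_).congr_right ?_
    · exact Eventually.of_forall fun x => by simp [sub_eq_add_neg]
    · exact Eventually.of_forall fun x => by simp
  · simpa using IsEquivalent.refl
  · exact key a h

/-! ### Integrating out an independent weight -/

section Independence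

variable {Ω E F : Type*} [MeasurableSpace Ω] [MeasurableSpace E] [MeasurableSpace F]
  {μ : Measure Ω} [IsProbabilityMeasure μ] {W : Ω → E} {Z : Ω → F}

lemma measurable_measureReal_section (hW : Measurable W) (hZ : Measurable Z) {S : Set (E × F)}
    (hS : MeasurableSet S) : Measurable fun ω => μ.real {ω' | (W ω, Z ω') ∈ S} := by
  have h : MeasurableSet {q : Ω × Ω | (W q.1, Z q.2) ∈ S} :=
    ((hW.comp measurable_fst).prodMk (hZ.comp measurable_snd)) hS
  exact (measurable_measure_prodMk_left (ν := μ) h).ennreal_toReal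

lemma integrable_measureReal_section (hW : Measurable W) (hZ : Measurable Z) {S : Set (E × F)}
    (hS : MeasurableSet S) : Integrable (fun ω => μ.real {ω' | (W ω, Z ω') ∈ S}) μ :=
  Integrable.of_bound (measurable_measureReal_section hW hZ hS).aestronglyMeasurable 1
    (Eventually.of_forall fun ω => by
      rw [Real.norm_of_nonneg measureReal_nonneg]; exact measureReal_le_one)

lemma measureReal_eq_integral_of_indepFun (hW : Measurable W) (hZ : Measurable Z)
    (h : IndepFun W Z μ) {S : Set (E × F)} (hS : MeasurableSet S) :
    μ.real {ω | (W ω, Z ω) ∈ S} = ∫ ω, μ.real {ω' | (W ω, Z ω') ∈ S} ∂μ := by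
  have h1 : μ {ω | (W ω, Z ω) ∈ S} = ∫⁻ ω, μ {ω' | (W ω, Z ω') ∈ S} ∂μ := by
    have := (indepFun_iff_map_prod_eq_prod_map_map hW.aemeasurable hZ.aemeasurable).1 h
    have h2 := congrArg (fun m => m S) this
    simp only [Measure.map_apply (hW.prodMk hZ) hS] at h2
    have hfin : SFinite (μ.map Z) := by
      have := Measure.isProbabilityMeasure_map (μ := μ) hZ.aemeasurable
      infer_instance
    rw [Measure.prod_apply hS, lintegral_map (measurable_measure_prodMk_left hS) hW] at h2
    refine h2.trans (lintegral_congr fun ω => ?_)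
    rw [Measure.map_apply hZ (measurable_prodMk_left hS)]
    rfl
  rw [integral_eq_lintegral_of_nonneg_ae (Eventually.of_forall fun ω => measureReal_nonneg)
    (measurable_measureReal_section hW hZ hS).aestronglyMeasurable, measureReal_def, h1]
  congr 1
  exact lintegral_congr fun ω => (ofReal_measureReal).symm

/-- By Fubini, an inequality proved for almost every frozen value of `W` survives integration;
random weights thus reduce to deterministic coefficients. -/
lemma measureReal_le_mul_of_indepFun (hW : Measurable W) (hZ : Measurable Z)
    (h : IndepFun W Z μ) {S T : Set (E × F)} (hS : MeasurableSet S) (hT : MeasurableSet T) {ε : ℝ}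
    (hle : ∀ᵐ ω ∂μ, μ.real {ω' | (W ω, Z ω') ∈ S} ≤ ε * μ.real {ω' | (W ω, Z ω') ∈ T}) :
    μ.real {ω | (W ω, Z ω) ∈ S} ≤ ε * μ.real {ω | (W ω, Z ω) ∈ T} := by
  rw [measureReal_eq_integral_of_indepFun hW hZ h hS,
    measureReal_eq_integral_of_indepFun hW hZ h hT, ← integral_const_mul]
  exact integral_mono_ae (integrable_measureReal_section hW hZ hS)
    ((integrable_measureReal_section hW hZ hT).const_mul ε) hle

end Independence

/-! ### One weighted pair -/

section WeightedPair

variable {Ω : Type*} [MeasurableSpace Ω]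

/-- The joint tail `P(V > x, Z > y)`. -/
noncomputable def jointTail (μ : Measure Ω) (V Z : Ω → ℝ) (p : ℝ × ℝ) : ℝ :=
  μ.real {ω | p.1 < V ω ∧ p.2 < Z ω}

/-- The product of the marginal tails of `V` and `Z`. -/
noncomputable def prodTail (μ : Measure Ω) (V Z : Ω → ℝ) (p : ℝ × ℝ) : ℝ :=
  tail (μ.map V) p.1 * tail (μ.map Z) p.2

/-- A pair of losses `V, Z`, whose joint tail is `c` times the product of the marginal tails, with
an independent pair of weights `A, D`. -/
structure WeightedPair (μ : Measure Ω) (A D V Z : Ω → ℝ) (c : ℝ) : Prop where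
  weight_left : IsWeight μ A
  weight_right : IsWeight μ D
  measurable_left : Measurable V
  measurable_right : Measurable Z
  indep : IndepFun (fun ω => (A ω, D ω)) (fun ω => (V ω, Z ω)) μ
  class_left : DominatedlyVarying (μ.map V) ∧ LongTailed (μ.map V)
  class_right : DominatedlyVarying (μ.map Z) ∧ LongTailed (μ.map Z)
  pos : 0 < c
  tails : Tendsto (fun p => jointTail μ V Z p / prodTail μ V Z p) (atTop ×ˢ atTop) (𝓝 c)

variable {μ : Measure Ω} {A D V Z : Ω → ℝ} {c : ℝ}

lemma jointTail_nonneg (p : ℝ × ℝ) : 0 ≤ jointTail μ V Z p := measureReal_nonneg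

lemma prodTail_nonneg (p : ℝ × ℝ) : 0 ≤ prodTail μ V Z p :=
  mul_nonneg (tail_nonneg _ _) (tail_nonneg _ _)

lemma tendsto_prodMap_mul_atTop {s t : ℝ} (hs : 0 < s) (ht : 0 < t) :
    Tendsto (fun p : ℝ × ℝ => (s * p.1, t * p.2)) (atTop ×ˢ atTop) (atTop ×ˢ atTop) :=
  (tendsto_id.const_mul_atTop hs).prodMap (tendsto_id.const_mul_atTop ht)

lemma tendsto_prodMap_sub_atTop (a b : ℝ) :
    Tendsto (fun p : ℝ × ℝ => (p.1 - a, p.2 - b)) (atTop ×ˢ atTop) (atTop ×ˢ atTop) :=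
  (tendsto_atTop_add_const_right atTop (-a) tendsto_id).prodMap
    (tendsto_atTop_add_const_right atTop (-b) tendsto_id)

lemma eventually_prod_ge (x y : ℝ) :
    ∀ᶠ p : ℝ × ℝ in atTop ×ˢ atTop, x ≤ p.1 ∧ y ≤ p.2 :=
  (eventually_ge_atTop x).prod_mk (eventually_ge_atTop y)

/-- The joint tail of the losses with the weights frozen at `a` and `d`. -/
lemma jointTail_const_mul {a d : ℝ} (ha : 0 < a) (hd : 0 < d) (p : ℝ × ℝ) :
    μ.real {ω | p.1 < a * V ω ∧ p.2 < d * Z ω} = jointTail μ V Z (a⁻¹ * p.1, d⁻¹ * p.2) := by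
  simp only [jointTail, inv_mul_lt_iff₀ ha, inv_mul_lt_iff₀ hd]

/-- A zero coefficient gives a zero product, which cannot strictly exceed a non-negative threshold.
-/
lemma jointTail_const_mul_eq_zero {a d : ℝ} (ha : 0 ≤ a) (hd : 0 ≤ d) (h : ¬(0 < a ∧ 0 < d))
    {p : ℝ × ℝ} (hp : 0 ≤ p.1 ∧ 0 ≤ p.2) :
    μ.real {ω | p.1 < a * V ω ∧ p.2 < d * Z ω} = 0 := by
  have : {ω | p.1 < a * V ω ∧ p.2 < d * Z ω} = ∅ := by
    ext ω
    simp only [Set.mem_ofPred_eq, Set.mem_empty_iff_false, iff_false, not_and]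
    intro h1 h2
    apply h
    refine ⟨ha.lt_of_ne ?_, hd.lt_of_ne ?_⟩
    · rintro rfl; linarith
    · rintro rfl; linarith
  simp [this]

lemma mixedMoment_nonneg (A D : Ω → ℝ) (α β : ℝ) : 0 ≤ mixedMoment μ A D α β := by
  refine integral_nonneg fun ω => mul_nonneg ?_ ?_ <;>
  · unfold zpowr
    split_ifs with h
    · exact Real.rpow_nonneg h.le _
    · exact le_rfl

namespace WeightedPair

lemma prodTail_pos (h : WeightedPair μ A D V Z c) (p : ℝ × ℝ) : 0 < prodTail μ V Z p :=
  mul_pos (h.class_left.1.1 _) (h.class_right.1.1 _)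

lemma isEquivalent_jointTail (h : WeightedPair μ A D V Z c) :
    jointTail μ V Z ~[atTop ×ˢ atTop] fun p => c * prodTail μ V Z p := by
  refine isEquivalent_of_tendsto_one ?_
  have := h.tails.div_const c
  rw [div_self h.pos.ne'] at this
  refine this.congr fun p => ?_
  simp only [Pi.div_apply]
  rw [div_div, mul_comm c]

lemma isBigO_jointTail (h : WeightedPair μ A D V Z c) :
    jointTail μ V Z =O[atTop ×ˢ atTop] prodTail μ V Z :=
  h.isEquivalent_jointTail.isBigO.trans (isBigO_const_mul_self c _ _)

lemma isBigO_prodTail (h : WeightedPair μ A D V Z c) :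
    prodTail μ V Z =O[atTop ×ˢ atTop] jointTail μ V Z :=
  (isBigO_self_const_mul h.pos.ne' _ _).trans h.isEquivalent_jointTail.isBigO_symm

lemma isEquivalent_prodTail_sub (h : WeightedPair μ A D V Z c) (a b : ℝ) :
    (fun p => prodTail μ V Z (p.1 - a, p.2 - b)) ~[atTop ×ˢ atTop] prodTail μ V Z :=
  ((h.class_left.2.isEquivalent_sub a).comp_tendsto tendsto_fst).mul
    ((h.class_right.2.isEquivalent_sub b).comp_tendsto tendsto_snd)

lemma isEquivalent_jointTail_sub (h : WeightedPair μ A D V Z c) (a b : ℝ) :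
    (fun p => jointTail μ V Z (p.1 - a, p.2 - b)) ~[atTop ×ˢ atTop] jointTail μ V Z := by
  have h1 := h.isEquivalent_jointTail.comp_tendsto (tendsto_prodMap_sub_atTop a b)
  refine h1.trans (IsEquivalent.trans ?_ h.isEquivalent_jointTail.symm)
  exact IsEquivalent.mul (IsEquivalent.refl (u := fun _ => c)) (h.isEquivalent_prodTail_sub a b)

lemma exists_bound (h : WeightedPair μ A D V Z c) :
    ∃ b : ℝ, 1 ≤ b ∧ ∀ᵐ ω ∂μ, (0 ≤ A ω ∧ A ω ≤ b) ∧ 0 ≤ D ω ∧ D ω ≤ b := by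
  obtain ⟨b, hb⟩ := h.weight_left.bounded
  obtain ⟨b', hb'⟩ := h.weight_right.bounded
  refine ⟨max 1 (max b b'), le_max_left _ _, ?_⟩
  filter_upwards [hb, hb', h.weight_left.nonneg, h.weight_right.nonneg] with ω h1 h2 h3 h4
  exact ⟨⟨h3, h1.trans ((le_max_left _ _).trans (le_max_right _ _))⟩, h4,
    h2.trans ((le_max_right _ _).trans (le_max_right _ _))⟩

lemma measurable_weights (h : WeightedPair μ A D V Z c) : Measurable fun ω => (A ω, D ω) :=
  h.weight_left.measurable.prodMk h.weight_right.measurable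

lemma measurable_losses (h : WeightedPair μ A D V Z c) : Measurable fun ω => (V ω, Z ω) :=
  h.measurable_left.prodMk h.measurable_right

lemma measurableSet_weighted_gt (p : ℝ × ℝ) :
    MeasurableSet {q : (ℝ × ℝ) × ℝ × ℝ | p.1 < q.1.1 * q.2.1 ∧ p.2 < q.1.2 * q.2.2} :=
  measurableSet_setOfPred.2 <| by
    refine Measurable.and (measurableSet_setOfPred.1 ?_) (measurableSet_setOfPred.1 ?_) <;>
      exact measurableSet_lt measurable_const (by fun_prop)

variable [IsProbabilityMeasure μ]

lemma isBigO_prodTail_mul (h : WeightedPair μ A D V Z c) {s t : ℝ} (hs : 0 < s) (ht : 0 < t) :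
    (fun p => prodTail μ V Z (s * p.1, t * p.2)) =O[atTop ×ˢ atTop] prodTail μ V Z :=
  ((h.class_left.1.isBigO_tail_mul hs).comp_tendsto tendsto_fst).mul
    ((h.class_right.1.isBigO_tail_mul ht).comp_tendsto tendsto_snd)

lemma isBigO_prodTail_of_mul (h : WeightedPair μ A D V Z c) {s t : ℝ} (hs : 0 < s)
    (ht : 0 < t) :
    prodTail μ V Z =O[atTop ×ˢ atTop] (fun p => prodTail μ V Z (s * p.1, t * p.2)) :=
  ((h.class_left.1.isBigO_tail hs).comp_tendsto tendsto_fst).mul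
    ((h.class_right.1.isBigO_tail ht).comp_tendsto tendsto_snd)

lemma isBigO_jointTail_mul (h : WeightedPair μ A D V Z c) {s t : ℝ} (hs : 0 < s) (ht : 0 < t) :
    (fun p => jointTail μ V Z (s * p.1, t * p.2)) =O[atTop ×ˢ atTop] prodTail μ V Z :=
  (h.isBigO_jointTail.comp_tendsto (tendsto_prodMap_mul_atTop hs ht)).trans
    (h.isBigO_prodTail_mul hs ht)

lemma jointTail_eq_integral (h : WeightedPair μ A D V Z c) (p : ℝ × ℝ) :
    jointTail μ (fun ω => A ω * V ω) (fun ω => D ω * Z ω) p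
      = ∫ ω, μ.real {ω' | p.1 < A ω * V ω' ∧ p.2 < D ω * Z ω'} ∂μ :=
  measureReal_eq_integral_of_indepFun h.measurable_weights h.measurable_losses h.indep
    (measurableSet_weighted_gt p)

lemma integrable_section (h : WeightedPair μ A D V Z c) (p : ℝ × ℝ) :
    Integrable (fun ω => μ.real {ω' | p.1 < A ω * V ω' ∧ p.2 < D ω * Z ω'}) μ :=
  integrable_measureReal_section h.measurable_weights h.measurable_losses
    (measurableSet_weighted_gt p)

/-- For non-negative thresholds, replacing both weights by their common upper bound `b` only
enlarges the event, and dominated variation absorbs the factor `b⁻¹`. The bound is uniform in the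
weights and serves as the majorant for dominated convergence. -/
lemma exists_section_bound (h : WeightedPair μ A D V Z c) :
    ∃ K : ℝ, ∀ᶠ p : ℝ × ℝ in atTop ×ˢ atTop, ∀ᵐ ω ∂μ,
      μ.real {ω' | p.1 < A ω * V ω' ∧ p.2 < D ω * Z ω'} ≤ K * prodTail μ V Z p := by
  obtain ⟨b, hb1, hb⟩ := h.exists_bound
  have hb0 : 0 < b := by linarith
  obtain ⟨K, hK⟩ := (h.isBigO_jointTail_mul (inv_pos.2 hb0) (inv_pos.2 hb0)).bound
  refine ⟨K, ?_⟩
  filter_upwards [hK, eventually_prod_ge 0 0] with p hp hp0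
  filter_upwards [hb] with ω hω
  rw [Real.norm_of_nonneg (jointTail_nonneg _), Real.norm_of_nonneg (prodTail_nonneg _)] at hp
  refine le_trans (measureReal_mono ?_) hp
  rintro ω' ⟨h1, h2⟩
  simp only [Set.mem_ofPred_eq, inv_mul_lt_iff₀ hb0]
  constructor <;> nlinarith [hω.1.1, hω.1.2, hω.2.1, hω.2.2, hp0.1, hp0.2]

lemma isBigO_weighted (h : WeightedPair μ A D V Z c) :
    jointTail μ (fun ω => A ω * V ω) (fun ω => D ω * Z ω) =O[atTop ×ˢ atTop]
      prodTail μ V Z := by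
  obtain ⟨K, hK⟩ := h.exists_section_bound
  refine IsBigO.of_bound K ?_
  filter_upwards [hK] with p hp
  rw [Real.norm_of_nonneg (jointTail_nonneg _), Real.norm_of_nonneg (prodTail_nonneg _),
    h.jointTail_eq_integral]
  refine (integral_mono_ae (h.integrable_section p) (integrable_const _) hp).trans ?_
  simp

/-- Two weights that are never positive together give a joint tail which is eventually zero. -/
lemma weighted_eq_zero (h : WeightedPair μ A D V Z c) (h0 : μ {ω | 0 < A ω ∧ 0 < D ω} = 0) :
    ∀ᶠ p in atTop ×ˢ atTop, jointTail μ (fun ω => A ω * V ω) (fun ω => D ω * Z ω) p = 0 := by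
  obtain ⟨b, hb1, hb⟩ := h.exists_bound
  filter_upwards [eventually_prod_ge 0 0] with p hp
  rw [h.jointTail_eq_integral]
  refine integral_eq_zero_of_ae ?_
  have h0' : ∀ᵐ ω ∂μ, ¬(0 < A ω ∧ 0 < D ω) := by rw [ae_iff]; simpa using h0
  filter_upwards [h0', hb] with ω h1 h2
  exact jointTail_const_mul_eq_zero h2.1.1 h2.2.1 h1 hp

/-- Some level `s > 0` is exceeded by both weights with positive probability. By independence, that
probability times the joint tail of the losses at `p / s` bounds the weighted tail from below, and
dominated variation replaces `p / s` by `p`. -/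
lemma isBigO_prodTail_weighted (h : WeightedPair μ A D V Z c)
    (h0 : μ {ω | 0 < A ω ∧ 0 < D ω} ≠ 0) :
    prodTail μ V Z =O[atTop ×ˢ atTop]
      jointTail μ (fun ω => A ω * V ω) (fun ω => D ω * Z ω) := by
  -- As `N` grows these events exhaust the event that both weights are positive.
  obtain ⟨N, hN⟩ : ∃ N : ℕ, μ {ω | ((N : ℝ) + 1)⁻¹ < A ω ∧ ((N : ℝ) + 1)⁻¹ < D ω} ≠ 0 := by
    by_contra! hcon
    apply h0
    refine measure_mono_null ?_ (measure_iUnion_null hcon)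
    rintro ω ⟨h1, h2⟩
    obtain ⟨N, hN⟩ := exists_nat_one_div_lt (lt_min h1 h2)
    rw [one_div] at hN
    exact Set.mem_iUnion.2 ⟨N, hN.trans_le (min_le_left _ _), hN.trans_le (min_le_right _ _)⟩
  set s : ℝ := ((N : ℝ) + 1)⁻¹
  have hs : 0 < s := by positivity
  have hm : 0 < μ.real {ω | s < A ω ∧ s < D ω} :=
    ENNReal.toReal_pos hN (measure_ne_top _ _)
  have h1 : prodTail μ V Z =O[atTop ×ˢ atTop]
      fun p => jointTail μ V Z (s⁻¹ * p.1, s⁻¹ * p.2) :=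
    (h.isBigO_prodTail_of_mul (inv_pos.2 hs) (inv_pos.2 hs)).trans
      (h.isBigO_prodTail.comp_tendsto
        (tendsto_prodMap_mul_atTop (inv_pos.2 hs) (inv_pos.2 hs)))
  refine h1.trans (IsBigO.of_bound (μ.real {ω | s < A ω ∧ s < D ω})⁻¹ ?_)
  filter_upwards [eventually_prod_ge 0 0] with p hp
  rw [Real.norm_of_nonneg (jointTail_nonneg _), Real.norm_of_nonneg (jointTail_nonneg _),
    le_inv_mul_iff₀ hm]
  have hi := h.indep.measure_inter_preimage_eq_mul _ _
    ((measurableSet_Ioi (a := s)).prod (measurableSet_Ioi (a := s)))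
    ((measurableSet_Ioi (a := s⁻¹ * p.1)).prod (measurableSet_Ioi (a := s⁻¹ * p.2)))
  have hi' := congrArg ENNReal.toReal hi
  rw [ENNReal.toReal_mul] at hi'
  refine le_trans (le_of_eq hi'.symm) (measureReal_mono ?_)
  rintro ω ⟨⟨h1, h2⟩, h3, h4⟩
  simp only [Set.mem_Ioi, inv_mul_lt_iff₀ hs] at h1 h2 h3 h4
  have hV : 0 < V ω := pos_of_mul_pos_right (hp.1.trans_lt h3) hs.le
  have hZ : 0 < Z ω := pos_of_mul_pos_right (hp.2.trans_lt h4) hs.le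
  exact ⟨h3.trans (mul_lt_mul_of_pos_right h1 hV), h4.trans (mul_lt_mul_of_pos_right h2 hZ)⟩

/-- Dividing by the coefficients turns the shift into `(a / s, b / t)`, still a constant. This is
the pointwise limit needed for dominated convergence. -/
lemma isLittleO_section_sub (h : WeightedPair μ A D V Z c) (a b : ℝ) {s t : ℝ} (hs : 0 ≤ s)
    (ht : 0 ≤ t) :
    (fun p : ℝ × ℝ => μ.real {ω | p.1 - a < s * V ω ∧ p.2 - b < t * Z ω}
        - μ.real {ω | p.1 < s * V ω ∧ p.2 < t * Z ω}) =o[atTop ×ˢ atTop] prodTail μ V Z := by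
  by_cases h0 : 0 < s ∧ 0 < t
  · have h1 := (h.isEquivalent_jointTail_sub (s⁻¹ * a) (t⁻¹ * b)).comp_tendsto
      (tendsto_prodMap_mul_atTop (inv_pos.2 h0.1) (inv_pos.2 h0.2))
    have h2 := h1.isLittleO.trans_isBigO
      (h.isBigO_jointTail_mul (inv_pos.2 h0.1) (inv_pos.2 h0.2))
    refine h2.congr_left fun p => ?_
    rw [jointTail_const_mul h0.1 h0.2 p, jointTail_const_mul h0.1 h0.2 (p.1 - a, p.2 - b)]
    simp [mul_sub]
  · refine IsLittleO.congr' (isLittleO_zero _ _) ?_ EventuallyEq.rfl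
    filter_upwards [eventually_prod_ge 0 0,
      (tendsto_prodMap_sub_atTop a b).eventually (eventually_prod_ge 0 0)] with p h1 h2
    rw [jointTail_const_mul_eq_zero hs ht h0 h1,
      jointTail_const_mul_eq_zero hs ht h0 (p := (p.1 - a, p.2 - b)) h2, sub_zero]

/-- The joint tail of the weighted losses is insensitive to shifts, relative to the product of the
marginal tails. -/
lemma isLittleO_weighted_sub (h : WeightedPair μ A D V Z c) (a b : ℝ) :
    (fun p : ℝ × ℝ => jointTail μ (fun ω => A ω * V ω) (fun ω => D ω * Z ω) (p.1 - a, p.2 - b)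
        - jointTail μ (fun ω => A ω * V ω) (fun ω => D ω * Z ω) p)
      =o[atTop ×ˢ atTop] prodTail μ V Z := by
  obtain ⟨K, hK⟩ := h.exists_section_bound
  obtain ⟨K', hK'⟩ := (h.isEquivalent_prodTail_sub a b).isBigO.bound
  obtain ⟨B, hB1, hB⟩ := h.exists_bound
  rw [isLittleO_iff_tendsto fun p hp => absurd hp (h.prodTail_pos p).ne']
  have hlim : Tendsto (fun p : ℝ × ℝ => ∫ ω,
      (μ.real {ω' | p.1 - a < A ω * V ω' ∧ p.2 - b < D ω * Z ω'} -
        μ.real {ω' | p.1 < A ω * V ω' ∧ p.2 < D ω * Z ω'}) / prodTail μ V Z p ∂μ)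
      (atTop ×ˢ atTop) (𝓝 (∫ _, (0 : ℝ) ∂μ)) := by
    -- The first term of the majorant handles the shifted section, with `K'` comparing shifted and
    -- unshifted product tails; the second handles the unshifted section.
    refine tendsto_integral_filter_of_dominated_convergence (fun _ => |K| * K' + |K|) ?_ ?_
      (integrable_const _) ?_
    · exact Eventually.of_forall fun p => (((h.integrable_section (p.1 - a, p.2 - b)).sub
        (h.integrable_section p)).div_const _).aestronglyMeasurable
    · filter_upwards [hK, (tendsto_prodMap_sub_atTop a b).eventually hK, hK'] with p h1 h2 h3
      filter_upwards [h1, h2] with ω h1 h2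
      have hg := h.prodTail_pos p
      rw [Real.norm_of_nonneg (prodTail_nonneg _), Real.norm_of_nonneg (prodTail_nonneg _)] at h3
      rw [norm_div, Real.norm_of_nonneg hg.le, div_le_iff₀ hg, Real.norm_eq_abs]
      refine (abs_sub _ _).trans ?_
      rw [abs_of_nonneg measureReal_nonneg, abs_of_nonneg measureReal_nonneg, add_mul, mul_assoc]
      refine add_le_add (h2.trans ?_)
        (h1.trans (mul_le_mul_of_nonneg_right (le_abs_self K) hg.le))
      exact (mul_le_mul_of_nonneg_right (le_abs_self K) (prodTail_nonneg _)).trans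
        (mul_le_mul_of_nonneg_left h3 (abs_nonneg K))
    · filter_upwards [hB] with ω hω
      exact (isLittleO_iff_tendsto fun p hp => absurd hp (h.prodTail_pos p).ne').1
        (h.isLittleO_section_sub a b hω.1.1 hω.2.1)
  rw [integral_zero] at hlim
  refine hlim.congr fun p => ?_
  rw [integral_div, integral_sub (h.integrable_section (p.1 - a, p.2 - b))
    (h.integrable_section p), h.jointTail_eq_integral, h.jointTail_eq_integral]

/-- If the weights are never positive together, both sides are eventually zero; otherwise the
product tail is dominated by the weighted tail, so the previous little-o is relative to the latter.
-/
lemma isEquivalent_weighted_sub (h : WeightedPair μ A D V Z c) (a b : ℝ) :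
    (fun p : ℝ × ℝ => jointTail μ (fun ω => A ω * V ω) (fun ω => D ω * Z ω) (p.1 - a, p.2 - b))
      ~[atTop ×ˢ atTop] jointTail μ (fun ω => A ω * V ω) (fun ω => D ω * Z ω) := by
  by_cases h0 : μ {ω | 0 < A ω ∧ 0 < D ω} = 0
  · refine EventuallyEq.isEquivalent ?_
    filter_upwards [h.weighted_eq_zero h0,
      (tendsto_prodMap_sub_atTop a b).eventually (h.weighted_eq_zero h0)] with p h1 h2
    rw [h1, h2]
  · exact (h.isLittleO_weighted_sub a b).trans_isBigO (h.isBigO_prodTail_weighted h0)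

lemma isBigO_weighted_mul (h : WeightedPair μ A D V Z c) {s t : ℝ} (hs : 0 < s) (ht : 0 < t) :
    (fun p : ℝ × ℝ => jointTail μ (fun ω => A ω * V ω) (fun ω => D ω * Z ω) (s * p.1, t * p.2))
      =O[atTop ×ˢ atTop] jointTail μ (fun ω => A ω * V ω) (fun ω => D ω * Z ω) := by
  by_cases h0 : μ {ω | 0 < A ω ∧ 0 < D ω} = 0
  · refine EventuallyEq.isBigO ?_
    filter_upwards [h.weighted_eq_zero h0,
      (tendsto_prodMap_mul_atTop hs ht).eventually (h.weighted_eq_zero h0)] with p h1 h2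
    rw [h1, h2]
  · exact ((h.isBigO_weighted.comp_tendsto (tendsto_prodMap_mul_atTop hs ht)).trans
      (h.isBigO_prodTail_mul hs ht)).trans (h.isBigO_prodTail_weighted h0)

/-- Breiman's theorem for a weighted pair with regularly varying marginals. -/
lemma tendsto_weighted_of_regularlyVarying (h : WeightedPair μ A D V Z c) {α β : ℝ}
    (hα : RegularlyVarying (μ.map V) α) (hβ : RegularlyVarying (μ.map Z) β) :
    Tendsto (fun p => jointTail μ (fun ω => A ω * V ω) (fun ω => D ω * Z ω) p / prodTail μ V Z p)
      (atTop ×ˢ atTop) (𝓝 (c * mixedMoment μ A D α β)) := by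
  obtain ⟨K, hK⟩ := h.exists_section_bound
  obtain ⟨B, hB1, hB⟩ := h.exists_bound
  rw [mixedMoment, ← integral_const_mul]
  have hlim : Tendsto (fun p : ℝ × ℝ => ∫ ω,
      μ.real {ω' | p.1 < A ω * V ω' ∧ p.2 < D ω * Z ω'} / prodTail μ V Z p ∂μ)
      (atTop ×ˢ atTop) (𝓝 (∫ ω, c * (zpowr (A ω) α * zpowr (D ω) β) ∂μ)) := by
    refine tendsto_integral_filter_of_dominated_convergence (fun _ => K) ?_ ?_
      (integrable_const _) ?_
    · exact Eventually.of_forall fun p => ((h.integrable_section p).div_const _).aestronglyMeasurable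
    · filter_upwards [hK] with p h1
      filter_upwards [h1] with ω h1
      have hg := h.prodTail_pos p
      rwa [norm_div, Real.norm_of_nonneg hg.le, div_le_iff₀ hg,
        Real.norm_of_nonneg measureReal_nonneg]
    · filter_upwards [hB] with ω hω
      by_cases h0 : 0 < A ω ∧ 0 < D ω
      · have hs := inv_pos.2 h0.1
        have ht := inv_pos.2 h0.2
        -- The quotient factors through the product tail at the rescaled point: strong asymptotic
        -- independence yields `c`, regular variation yields the powers of the weights.
        have h1 := (h.tails.comp (tendsto_prodMap_mul_atTop hs ht)).mul
          (((hα.2 _ hs).comp tendsto_fst).mul ((hβ.2 _ ht).comp tendsto_snd))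
        rw [Real.inv_rpow h0.1.le, Real.inv_rpow h0.2.le, Real.rpow_neg h0.1.le,
          Real.rpow_neg h0.2.le, inv_inv, inv_inv] at h1
        simp only [zpowr, if_pos h0.1, if_pos h0.2]
        refine h1.congr fun p => ?_
        rw [jointTail_const_mul h0.1 h0.2]
        have := (h.prodTail_pos ((A ω)⁻¹ * p.1, (D ω)⁻¹ * p.2)).ne'
        simp only [Function.comp_apply]
        rw [div_mul_div_comm]
        change _ * (prodTail μ V Z ((A ω)⁻¹ * p.1, (D ω)⁻¹ * p.2) / prodTail μ V Z p) = _
        rw [div_mul_div_cancel₀ this]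
      -- The convention `0 ^ 0 = 0` matters here: a vanishing weight gives a vanishing section even
      -- for slowly varying tails.
      · have : c * (zpowr (A ω) α * zpowr (D ω) β) = 0 := by
          simp only [zpowr]
          rcases not_and_or.1 h0 with h0 | h0 <;> simp [h0]
        rw [this]
        refine tendsto_const_nhds.congr' ?_
        filter_upwards [eventually_prod_ge 0 0] with p hp
        rw [jointTail_const_mul_eq_zero hω.1.1 hω.2.1 h0 hp, zero_div]
  refine hlim.congr fun p => ?_
  rw [integral_div, h.jointTail_eq_integral]

lemma isEquivalent_weighted_of_regularlyVarying (h : WeightedPair μ A D V Z c) {α β : ℝ}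
    (hα : RegularlyVarying (μ.map V) α) (hβ : RegularlyVarying (μ.map Z) β) :
    jointTail μ (fun ω => A ω * V ω) (fun ω => D ω * Z ω) ~[atTop ×ˢ atTop]
      fun p => c * mixedMoment μ A D α β * prodTail μ V Z p := by
  have hlim := h.tendsto_weighted_of_regularlyVarying hα hβ
  by_cases h0 : μ {ω | 0 < A ω ∧ 0 < D ω} = 0
  · have hm : c * mixedMoment μ A D α β = 0 := by
      refine tendsto_nhds_unique hlim (tendsto_const_nhds.congr' ?_)
      filter_upwards [h.weighted_eq_zero h0] with p hp
      rw [hp, zero_div]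
    refine EventuallyEq.isEquivalent ?_
    filter_upwards [h.weighted_eq_zero h0] with p hp
    rw [hp, hm, zero_mul]
  · have hm : c * mixedMoment μ A D α β ≠ 0 := by
      -- A zero limit would make the strictly positive product tail little-o of itself.
      intro hm
      rw [hm] at hlim
      have hlo := (isLittleO_iff_tendsto fun p hp => absurd hp (h.prodTail_pos p).ne').2 hlim
      have := (h.isBigO_prodTail_weighted h0).trans_isLittleO hlo
      obtain ⟨p, hp⟩ := (this.def (c := 1 / 2) (by norm_num)).exists
      rw [Real.norm_of_nonneg (prodTail_nonneg _)] at hp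
      linarith [h.prodTail_pos p]
    refine isEquivalent_of_tendsto_one ?_
    have h1 := hlim.div_const (c * mixedMoment μ A D α β)
    rw [div_self hm] at h1
    refine h1.congr fun p => ?_
    simp only [Pi.div_apply]
    rw [div_div, mul_comm (prodTail μ V Z p)]

end WeightedPair

end WeightedPair

/-! ### Sums with one dominating summand -/

lemma exists_gt_of_lt_sum {n k : ℕ} {a : ℕ → ℝ} {x L : ℝ} (hx : 0 < x) (hL : 0 ≤ L)
    (hk : k ∈ Finset.Icc 1 n) (h : x < ∑ i ∈ Finset.Icc 1 k, a i) :
    ∃ i ∈ Finset.Icc 1 n, (2 * n : ℝ)⁻¹ * x < a i ∧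
      (x - n * L < a i ∨ ∃ m ∈ Finset.Icc 1 n, m ≠ i ∧ L < |a m|) := by
  -- The maximum runs over all of `1, …, n`, so `i` may lie beyond `k`; positivity of `a i` covers
  -- that case below.
  obtain ⟨i, hi, hmax⟩ := (Finset.Icc 1 n).exists_max_image a ⟨k, hk⟩
  rw [Finset.mem_Icc] at hk
  have hk0 : (0 : ℝ) < k := by exact_mod_cast hk.1
  have hkn : (k : ℝ) ≤ n := by exact_mod_cast hk.2
  have hsub : Finset.Icc 1 k ⊆ Finset.Icc 1 n := Finset.Icc_subset_Icc_right hk.2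
  have hgt : (2 * n : ℝ)⁻¹ * x < a i := by
    have h1 : ∑ m ∈ Finset.Icc 1 k, a m ≤ k * a i := by
      have := Finset.sum_le_card_nsmul (Finset.Icc 1 k) a (a i) fun m hm => hmax m (hsub hm)
      simpa using this
    rw [inv_mul_lt_iff₀ (by linarith)]
    have : 0 < a i := pos_of_mul_pos_right ((hx.trans h).trans_le h1) hk0.le
    nlinarith
  refine ⟨i, hi, hgt, ?_⟩
  by_contra! hcon
  have hai : 0 < a i := lt_of_le_of_lt (by positivity) hgt
  have h2 : ∑ m ∈ Finset.Icc 1 k, a m ≤ ∑ m ∈ Finset.Icc 1 k, (L + if m = i then a i else 0) := by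
    refine Finset.sum_le_sum fun m hm => ?_
    split_ifs with hmi
    · rw [hmi]; linarith
    · linarith [le_abs_self (a m), hcon.2 m (hsub hm) hmi]
  rw [Finset.sum_add_distrib, Finset.sum_ite_eq'] at h2
  have h3 : (if i ∈ Finset.Icc 1 k then a i else 0) ≤ a i := by
    split_ifs <;> linarith
  have h4 : ∑ _m ∈ Finset.Icc 1 k, L = k * L := by simp
  nlinarith [hcon.1]

lemma lt_sum_of_gt {n i : ℕ} {a : ℕ → ℝ} {x L : ℝ} (hL : 0 ≤ L) (hi : i ∈ Finset.Icc 1 n)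
    (h : x + n * L < a i) (hothers : ∀ m ∈ Finset.Icc 1 n, m ≠ i → |a m| ≤ L) :
    x < ∑ m ∈ Finset.Icc 1 n, a m := by
  have h2 : ∑ m ∈ Finset.Icc 1 n, (-L + if m = i then a i else 0) ≤ ∑ m ∈ Finset.Icc 1 n, a m := by
    refine Finset.sum_le_sum fun m hm => ?_
    split_ifs with hmi
    · rw [hmi]; linarith
    · linarith [neg_abs_le (a m), hothers m hm hmi]
  rw [Finset.sum_add_distrib, Finset.sum_ite_eq', if_pos hi] at h2
  have h4 : ∑ _m ∈ Finset.Icc 1 n, -L = -(n * L) := by simp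
  linarith

section Sums

variable {Ω : Type*}

/-- The event that a summand other than `a i` and `b j` exceeds `L` in absolute value. -/
def otherLarge (n : ℕ) (a b : ℕ → Ω → ℝ) (i j : ℕ) (L : ℝ) : Set Ω :=
  (⋃ k ∈ (Finset.Icc 1 n).erase i, {ω | L < |a k ω|}) ∪
    ⋃ k ∈ (Finset.Icc 1 n).erase j, {ω | L < |b k ω|}

lemma mem_otherLarge {n : ℕ} {a b : ℕ → Ω → ℝ} {i j : ℕ} {L : ℝ} {ω : Ω} :
    ω ∈ otherLarge n a b i j L ↔ (∃ m ∈ Finset.Icc 1 n, m ≠ i ∧ L < |a m ω|) ∨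
      ∃ m ∈ Finset.Icc 1 n, m ≠ j ∧ L < |b m ω| := by
  simp only [otherLarge, Set.mem_union, Set.mem_iUnion, Set.mem_ofPred_eq, Finset.mem_erase,
    exists_prop]
  constructor <;> rintro (⟨k, h, h'⟩ | ⟨k, h, h'⟩)
  · exact .inl ⟨k, h.2, h.1, h'⟩
  · exact .inr ⟨k, h.2, h.1, h'⟩
  · exact .inl ⟨k, ⟨h'.1, h⟩, h'.2⟩
  · exact .inr ⟨k, ⟨h'.1, h⟩, h'.2⟩

variable [MeasurableSpace Ω] {μ : Measure Ω}

lemma measurableSet_otherLarge {n : ℕ} {a b : ℕ → Ω → ℝ}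
    (ha : ∀ i ∈ Finset.Icc 1 n, Measurable (a i)) (hb : ∀ i ∈ Finset.Icc 1 n, Measurable (b i))
    (i j : ℕ) (L : ℝ) : MeasurableSet (otherLarge n a b i j L) := by
  refine .union (Finset.measurableSet_biUnion _ fun k hk => ?_)
    (Finset.measurableSet_biUnion _ fun k hk => ?_)
  · exact measurableSet_lt measurable_const (ha k (Finset.mem_of_mem_erase hk)).abs
  · exact measurableSet_lt measurable_const (hb k (Finset.mem_of_mem_erase hk)).abs

/-- Summands whose joint tails are insensitive to shifts and dominatedly varying, and of which at
most one from each family is large. -/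
structure SingleJump (μ : Measure Ω) (n : ℕ) (a b : ℕ → Ω → ℝ) : Prop where
  measurable_left : ∀ i ∈ Finset.Icc 1 n, Measurable (a i)
  measurable_right : ∀ i ∈ Finset.Icc 1 n, Measurable (b i)
  shift : ∀ i ∈ Finset.Icc 1 n, ∀ j ∈ Finset.Icc 1 n, ∀ l : ℝ,
    (fun p : ℝ × ℝ => jointTail μ (a i) (b j) (p.1 - l, p.2 - l)) ~[atTop ×ˢ atTop]
      jointTail μ (a i) (b j)
  scale : ∀ i ∈ Finset.Icc 1 n, ∀ j ∈ Finset.Icc 1 n, ∀ s : ℝ, 0 < s →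
    (fun p : ℝ × ℝ => jointTail μ (a i) (b j) (s * p.1, s * p.2)) =O[atTop ×ˢ atTop]
      jointTail μ (a i) (b j)
  others : ∀ i ∈ Finset.Icc 1 n, ∀ j ∈ Finset.Icc 1 n, ∀ ε : ℝ, 0 < ε → ∀ᶠ L in atTop,
    ∀ᶠ p : ℝ × ℝ in atTop ×ˢ atTop,
      μ.real ({ω | p.1 < a i ω ∧ p.2 < b j ω} ∩ otherLarge n a b i j L) ≤
        ε * jointTail μ (a i) (b j) p

/-- The sum of the joint tails of all pairs of summands. -/
noncomputable def pairTailSum (μ : Measure Ω) (n : ℕ) (a b : ℕ → Ω → ℝ) (p : ℝ × ℝ) : ℝ :=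
  ∑ i ∈ Finset.Icc 1 n, ∑ j ∈ Finset.Icc 1 n, jointTail μ (a i) (b j) p

lemma pairTailSum_nonneg (n : ℕ) (a b : ℕ → Ω → ℝ) (p : ℝ × ℝ) : 0 ≤ pairTailSum μ n a b p :=
  Finset.sum_nonneg fun _ _ => Finset.sum_nonneg fun _ _ => jointTail_nonneg _

lemma eventually_bounds_of_isEquivalent {ι : Type*} {l : Filter ι} {f g : ι → ℝ} (h : f ~[l] g)
    (hg : ∀ p, 0 ≤ g p) {δ : ℝ} (hδ : 0 < δ) :
    ∀ᶠ p in l, (1 - δ) * g p ≤ f p ∧ f p ≤ (1 + δ) * g p := by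
  filter_upwards [h.isLittleO.def hδ] with p hp
  rw [Real.norm_of_nonneg (hg p), Real.norm_eq_abs, Pi.sub_apply, abs_le] at hp
  constructor <;> linarith [hp.1, hp.2]

variable [IsProbabilityMeasure μ] {n : ℕ} {a b : ℕ → Ω → ℝ}

/-- A union bound over the pairs of dominating indices. Half of `δ` pays for the shift by `n * L`,
the other half for a third large summand. -/
lemma SingleJump.eventually_le (h : SingleJump μ n a b) {δ : ℝ} (hδ : 0 < δ) :
    ∀ᶠ p : ℝ × ℝ in atTop ×ˢ atTop,
      μ.real {ω | (∃ k ∈ Finset.Icc 1 n, p.1 < ∑ i ∈ Finset.Icc 1 k, a i ω) ∧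
        ∃ k ∈ Finset.Icc 1 n, p.2 < ∑ i ∈ Finset.Icc 1 k, b i ω} ≤
      (1 + δ) * pairTailSum μ n a b p := by
  rcases Nat.eq_zero_or_pos n with rfl | hn
  · simp [pairTailSum]
  have hn' : (0 : ℝ) < n := by exact_mod_cast hn
  have hs : 0 < (2 * n : ℝ)⁻¹ := by positivity
  have key : ∀ i ∈ Finset.Icc 1 n, ∀ j ∈ Finset.Icc 1 n, ∀ᶠ L in atTop,
      ∀ᶠ p : ℝ × ℝ in atTop ×ˢ atTop,
      μ.real ({ω | (2 * n : ℝ)⁻¹ * p.1 < a i ω ∧ (2 * n : ℝ)⁻¹ * p.2 < b j ω} ∩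
        otherLarge n a b i j L) ≤ δ / 2 * jointTail μ (a i) (b j) p := by
    intro i hi j hj
    obtain ⟨K, hK0, hK⟩ := (h.scale i hi j hj _ hs).exists_pos
    -- Dividing by `K` compensates for returning from thresholds scaled by `(2 * n)⁻¹` to the
    -- original ones.
    filter_upwards [h.others i hi j hj (δ / 2 / K) (by positivity)] with L hL
    filter_upwards [hK.bound, (tendsto_prodMap_mul_atTop hs hs).eventually hL] with p h1 h2
    rw [Real.norm_of_nonneg (jointTail_nonneg _), Real.norm_of_nonneg (jointTail_nonneg _)] at h1
    refine h2.trans ((mul_le_mul_of_nonneg_left h1 (by positivity)).trans (le_of_eq ?_))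
    field_simp
  obtain ⟨L, hL, hL0⟩ := (((Finset.eventually_all _).2 fun i hi =>
    (Finset.eventually_all _).2 (key i hi)).and (eventually_ge_atTop 0)).exists
  have hshift : ∀ᶠ p : ℝ × ℝ in atTop ×ˢ atTop, ∀ i ∈ Finset.Icc 1 n, ∀ j ∈ Finset.Icc 1 n,
      jointTail μ (a i) (b j) (p.1 - n * L, p.2 - n * L) ≤
        (1 + δ / 2) * jointTail μ (a i) (b j) p := by
    refine (Finset.eventually_all _).2 fun i hi => (Finset.eventually_all _).2 fun j hj => ?_
    exact (eventually_bounds_of_isEquivalent (h.shift i hi j hj (n * L))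
      (fun p => jointTail_nonneg p) (half_pos hδ)).mono fun p hp => hp.2
  filter_upwards [(Finset.eventually_all _).2 fun i hi => (Finset.eventually_all _).2 (hL i hi),
    hshift, eventually_prod_ge 1 1] with p h1 h2 hp
  have hsub : {ω | (∃ k ∈ Finset.Icc 1 n, p.1 < ∑ i ∈ Finset.Icc 1 k, a i ω) ∧
        ∃ k ∈ Finset.Icc 1 n, p.2 < ∑ i ∈ Finset.Icc 1 k, b i ω} ⊆
      ⋃ i ∈ Finset.Icc 1 n, ⋃ j ∈ Finset.Icc 1 n,
        {ω | p.1 - n * L < a i ω ∧ p.2 - n * L < b j ω} ∪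
        ({ω | (2 * n : ℝ)⁻¹ * p.1 < a i ω ∧ (2 * n : ℝ)⁻¹ * p.2 < b j ω} ∩
          otherLarge n a b i j L) := by
    rintro ω ⟨⟨k, hk, hka⟩, l, hl, hlb⟩
    obtain ⟨i, hi, hi1, hi2⟩ := exists_gt_of_lt_sum (by linarith [hp.1]) hL0 hk hka
    obtain ⟨j, hj, hj1, hj2⟩ := exists_gt_of_lt_sum (by linarith [hp.2]) hL0 hl hlb
    simp only [Set.mem_iUnion]
    refine ⟨i, hi, j, hj, ?_⟩
    by_cases ho : ω ∈ otherLarge n a b i j L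
    · exact .inr ⟨⟨hi1, hj1⟩, ho⟩
    · rw [mem_otherLarge, not_or] at ho
      exact .inl ⟨hi2.resolve_right ho.1, hj2.resolve_right ho.2⟩
  refine (measureReal_mono hsub (measure_ne_top _ _)).trans ((measureReal_biUnion_finset_le _ _).trans ?_)
  rw [pairTailSum, Finset.mul_sum]
  refine Finset.sum_le_sum fun i hi => (measureReal_biUnion_finset_le _ _).trans ?_
  rw [Finset.mul_sum]
  refine Finset.sum_le_sum fun j hj => (measureReal_union_le _ _).trans ?_
  have h3 := h2 i hi j hj
  have h4 := h1 i hi j hj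
  simp only [jointTail] at h3 h4 ⊢
  linarith

lemma SingleJump.eventually_ge (h : SingleJump μ n a b) {δ : ℝ} (hδ : 0 < δ) :
    ∀ᶠ p : ℝ × ℝ in atTop ×ˢ atTop, (1 - δ) * pairTailSum μ n a b p ≤
      jointTail μ (fun ω => ∑ i ∈ Finset.Icc 1 n, a i ω) (fun ω => ∑ i ∈ Finset.Icc 1 n, b i ω)
        p := by
  -- One factor `1 - η` is lost to the shift and one to the other summands, and `(1 - η) ^ 2 ≥ 1 - 2
  -- * η ≥ 1 - δ`.
  obtain ⟨η, hη, hη1, hηδ⟩ : ∃ η : ℝ, 0 < η ∧ η ≤ 1 ∧ 2 * η ≤ δ :=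
    ⟨min 1 (δ / 2), by positivity, min_le_left _ _, by linarith [min_le_right 1 (δ / 2)]⟩
  obtain ⟨L, hL, hL0⟩ := (((Finset.eventually_all _).2 fun i hi =>
    (Finset.eventually_all _).2 fun j hj => h.others i hi j hj η hη).and
      (eventually_ge_atTop 0)).exists
  have hbound : ∀ᶠ p : ℝ × ℝ in atTop ×ˢ atTop, ∀ i ∈ Finset.Icc 1 n, ∀ j ∈ Finset.Icc 1 n,
      (1 - δ) * jointTail μ (a i) (b j) p ≤
        μ.real ({ω | p.1 + n * L < a i ω ∧ p.2 + n * L < b j ω} \ otherLarge n a b i j L) := by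
    refine (Finset.eventually_all _).2 fun i hi => (Finset.eventually_all _).2 fun j hj => ?_
    filter_upwards [eventually_bounds_of_isEquivalent (h.shift i hi j hj (-(n * L)))
        (fun p => jointTail_nonneg p) hη,
      (tendsto_prodMap_sub_atTop (-(n * L)) (-(n * L))).eventually (hL i hi j hj)] with p h1 h2
    simp only [sub_neg_eq_add] at h1 h2
    have h3 := measureReal_sdiff_add_inter (μ := μ)
      (s := {ω | p.1 + n * L < a i ω ∧ p.2 + n * L < b j ω})
      (measurableSet_otherLarge h.measurable_left h.measurable_right i j L)
    have h4 := jointTail_nonneg (μ := μ) (V := a i) (Z := b j) p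
    have h5 : (1 - η) * jointTail μ (a i) (b j) (p.1 + n * L, p.2 + n * L) ≤
        μ.real ({ω | p.1 + n * L < a i ω ∧ p.2 + n * L < b j ω} \ otherLarge n a b i j L) := by
      simp only [jointTail] at h2 ⊢
      linarith
    nlinarith [h1.1, mul_nonneg (sq_nonneg η) h4]
  filter_upwards [hbound, eventually_prod_ge 0 0] with p h1 hp
  have hmeas : ∀ q ∈ Finset.Icc 1 n ×ˢ Finset.Icc 1 n, MeasurableSet
      ({ω | p.1 + n * L < a q.1 ω ∧ p.2 + n * L < b q.2 ω} \ otherLarge n a b q.1 q.2 L) := by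
    intro q hq
    rw [Finset.mem_product] at hq
    refine MeasurableSet.diff (measurableSet_setOfPred.2 ?_)
      (measurableSet_otherLarge h.measurable_left h.measurable_right _ _ _)
    exact .and (measurableSet_setOfPred.1 (measurableSet_lt measurable_const
      (h.measurable_left _ hq.1))) (measurableSet_setOfPred.1 (measurableSet_lt measurable_const
      (h.measurable_right _ hq.2)))
  -- If two index pairs differ, one event makes some summand exceed `n * L ≥ L`, while the other
  -- bounds that same summand by `L`.
  have hdisj : Set.PairwiseDisjoint (↑(Finset.Icc 1 n ×ˢ Finset.Icc 1 n)) fun q : ℕ × ℕ =>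
      {ω | p.1 + n * L < a q.1 ω ∧ p.2 + n * L < b q.2 ω} \ otherLarge n a b q.1 q.2 L := by
    rintro ⟨i, j⟩ hq ⟨i', j'⟩ hq' hne
    simp only [Finset.coe_product, Set.mem_prod, Finset.mem_coe] at hq hq'
    have hnL : L ≤ n * L := by
      have : (1 : ℝ) ≤ n := by
        exact_mod_cast (Finset.mem_Icc.1 hq.1).1.trans (Finset.mem_Icc.1 hq.1).2
      nlinarith
    refine Set.disjoint_left.2 ?_
    rintro ω ⟨⟨ha1, hb1⟩, -⟩ ⟨-, ho⟩
    rw [mem_otherLarge] at ho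
    push Not at ho
    dsimp only at ha1 hb1
    by_cases hii : i = i'
    · have hjj : j ≠ j' := fun hjj => hne (by rw [hii, hjj])
      linarith [ho.2 j hq.2 hjj, le_abs_self (b j ω), hp.2]
    · linarith [ho.1 i hq.1 hii, le_abs_self (a i ω), hp.1]
  rw [pairTailSum, ← Finset.sum_product', Finset.mul_sum]
  refine (Finset.sum_le_sum fun q hq => h1 q.1 (Finset.mem_product.1 hq).1 q.2
    (Finset.mem_product.1 hq).2).trans ?_
  rw [← measureReal_biUnion_finset hdisj hmeas]
  refine measureReal_mono fun ω hω => ?_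
  simp only [Set.mem_iUnion] at hω
  obtain ⟨q, hq, ⟨ha1, hb1⟩, ho⟩ := hω
  rw [mem_otherLarge] at ho
  push Not at ho
  rw [Finset.mem_product] at hq
  exact ⟨lt_sum_of_gt hL0 hq.1 ha1 ho.1, lt_sum_of_gt hL0 hq.2 hb1 ho.2⟩

lemma SingleJump.isEquivalent_of_between (h : SingleJump μ n a b) {f : ℝ × ℝ → ℝ}
    (hlow : ∀ p, jointTail μ (fun ω => ∑ i ∈ Finset.Icc 1 n, a i ω)
      (fun ω => ∑ i ∈ Finset.Icc 1 n, b i ω) p ≤ f p)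
    (hup : ∀ p, f p ≤ μ.real {ω | (∃ k ∈ Finset.Icc 1 n, p.1 < ∑ i ∈ Finset.Icc 1 k, a i ω) ∧
        ∃ k ∈ Finset.Icc 1 n, p.2 < ∑ i ∈ Finset.Icc 1 k, b i ω}) :
    f ~[atTop ×ˢ atTop] pairTailSum μ n a b := by
  refine isLittleO_iff.2 fun δ hδ => ?_
  filter_upwards [h.eventually_le hδ, h.eventually_ge hδ] with p h1 h2
  rw [Real.norm_of_nonneg (pairTailSum_nonneg _ _ _ _), Real.norm_eq_abs, Pi.sub_apply, abs_le]
  constructor <;> linarith [hlow p, hup p]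

end Sums

/-! ### The model satisfies the single-jump conditions -/

section Model

variable {Ω : Type*} [MeasurableSpace Ω] {μ : Measure Ω} {n : ℕ}
  {Θ Δ X Y : ℕ → Ω → ℝ} {C : ℕ → ℝ}

lemma Model.weightedPair (h : Model μ n Θ Δ X Y C) {i j : ℕ} (hi : i ∈ Finset.Icc 1 n)
    (hj : j ∈ Finset.Icc 1 n) :
    WeightedPair μ (Θ i) (Δ j) (X i) (Y j) (if i = j then C i else 1) where
  weight_left := h.weight_left i hi
  weight_right := h.weight_right j hj
  measurable_left := h.measurable_X i hi
  measurable_right := h.measurable_Y j hj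
  indep := h.indep_weights.comp
    (φ := fun w => ((w ⟨i, hi⟩).1, (w ⟨j, hj⟩).2)) (ψ := fun w => ((w ⟨i, hi⟩).1, (w ⟨j, hj⟩).2))
    (by fun_prop) (by fun_prop)
  class_left := h.class_X i hi
  class_right := h.class_Y j hj
  pos := by
    split_ifs with hij
    · exact (h.sai i hi).pos
    · exact one_pos
  tails := by
    simp only [prodTail, tail_map (h.measurable_X i hi), tail_map (h.measurable_Y j hj)]
    split_ifs with hij
    · subst hij
      exact (h.sai i hi).tails
    · refine tendsto_const_nhds.congr fun p => ?_
      have h1 := (h.indep i hi j hj hij).measure_inter_preimage_eq_mul _ _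
        (measurableSet_Ioi (a := p.1)) (measurableSet_Ioi (a := p.2))
      have h2 := congrArg ENNReal.toReal h1
      rw [ENNReal.toReal_mul] at h2
      have hX := (h.class_X i hi).1.1 p.1
      have hY := (h.class_Y j hj).1.1 p.2
      rw [tail_map (h.measurable_X i hi)] at hX
      rw [tail_map (h.measurable_Y j hj)] at hY
      exact ((div_eq_one_iff_eq (mul_pos hX hY).ne').2 h2).symm

variable [IsProbabilityMeasure μ]

/-- A conditional limit of tail events, with the conditioning multiplied out. -/
lemma exists_threshold_of_tendsto_cond {U V Z : Ω → ℝ} (hV : Measurable V) (hZ : Measurable Z)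
    (h : Tendsto (fun p : ℝ × ℝ × ℝ =>
        (cond μ {ω | p.2.1 < V ω ∧ p.2.2 < Z ω}).real {ω | p.1 < |U ω|})
      (atTop ×ˢ atTop ×ˢ atTop) (𝓝 0)) {ε : ℝ} (hε : 0 < ε) :
    ∃ N : ℝ, 0 ≤ N ∧ ∀ x y, N ≤ x → N ≤ y →
      μ.real {ω | x < V ω ∧ y < Z ω ∧ N < |U ω|} ≤ ε * jointTail μ V Z (x, y) := by
  have h1 := h.eventually_le_const hε
  rw [prod_atTop_atTop_eq, prod_atTop_atTop_eq, eventually_atTop] at h1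
  obtain ⟨⟨a, b, c⟩, habc⟩ := h1
  refine ⟨max (max a 0) (max b c), (le_max_right _ _).trans (le_max_left _ _),
    fun x y hx hy => ?_⟩
  set N := max (max a 0) (max b c)
  have h2 := habc (N, x, y) ⟨(le_max_left _ _).trans (le_max_left _ _),
    ((le_max_left _ _).trans (le_max_right _ _)).trans hx,
    ((le_max_right _ _).trans (le_max_right _ _)).trans hy⟩
  have hms : MeasurableSet {ω | x < V ω ∧ y < Z ω} :=
    measurableSet_setOfPred.2 (.and (measurableSet_setOfPred.1 (measurableSet_lt measurable_const hV))
      (measurableSet_setOfPred.1 (measurableSet_lt measurable_const hZ)))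
  have heq : {ω | x < V ω ∧ y < Z ω ∧ N < |U ω|} =
      {ω | x < V ω ∧ y < Z ω} ∩ {ω | N < |U ω|} := by
    ext ω; simp [and_assoc]
  rw [heq, jointTail]
  -- Conditioning on a null event carries no information, but then both sides vanish.
  by_cases h0 : μ.real {ω | x < V ω ∧ y < Z ω} = 0
  · rw [h0, mul_zero]
    exact (measureReal_mono Set.inter_subset_left).trans h0.le
  · have h0' : 0 < μ.real {ω | x < V ω ∧ y < Z ω} := measureReal_nonneg.lt_of_ne' h0
    dsimp only at h2
    rw [measureReal_def, cond_apply hms, ENNReal.toReal_mul, ENNReal.toReal_inv,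
      ← measureReal_def, ← measureReal_def, inv_mul_le_iff₀ h0', mul_comm] at h2
    exact h2

/-- Since `W ≤ B'`, a product above `L ≥ B' * N` forces `|U| > N`, which eliminates `W` whatever its
dependence on the other weights. With `A` and `D` frozen and at most `B`, thresholds above `B * N`
leave rescaled thresholds above `N`, where the conditional limit applies uniformly. -/
lemma WeightedPair.eventually_third_le {A D V Z : Ω → ℝ} {c : ℝ} (h : WeightedPair μ A D V Z c)
    {U W : Ω → ℝ} (hU : Measurable U) (hW : IsWeight μ W)
    (hind : IndepFun (fun ω => (A ω, D ω)) (fun ω => (U ω, V ω, Z ω)) μ)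
    (hlim : Tendsto (fun p : ℝ × ℝ × ℝ =>
        (cond μ {ω | p.2.1 < V ω ∧ p.2.2 < Z ω}).real {ω | p.1 < |U ω|})
      (atTop ×ˢ atTop ×ˢ atTop) (𝓝 0)) {ε : ℝ} (hε : 0 < ε) :
    ∀ᶠ L in atTop, ∀ᶠ p : ℝ × ℝ in atTop ×ˢ atTop,
      μ.real {ω | (p.1 < A ω * V ω ∧ p.2 < D ω * Z ω) ∧ L < |W ω * U ω|} ≤
        ε * jointTail μ (fun ω => A ω * V ω) (fun ω => D ω * Z ω) p := by
  obtain ⟨N, hN0, hN⟩ :=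
    exists_threshold_of_tendsto_cond h.measurable_left h.measurable_right hlim hε
  obtain ⟨B, hB1, hB⟩ := h.exists_bound
  obtain ⟨B', hB'⟩ := hW.bounded
  filter_upwards [eventually_ge_atTop (B' * N)] with L hL
  filter_upwards [eventually_prod_ge (B * N) (B * N)] with p hp
  have hp0 : 0 ≤ p.1 ∧ 0 ≤ p.2 := by
    have : 0 ≤ B * N := by positivity
    exact ⟨this.trans hp.1, this.trans hp.2⟩
  have h1 : μ.real {ω | (p.1 < A ω * V ω ∧ p.2 < D ω * Z ω) ∧ L < |W ω * U ω|} ≤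
      μ.real {ω | p.1 < A ω * V ω ∧ p.2 < D ω * Z ω ∧ N < |U ω|} := by
    refine ENNReal.toReal_mono (measure_ne_top _ _) (measure_mono_ae ?_)
    filter_upwards [hB', hW.nonneg] with ω h1 h2 h3
    refine ⟨h3.1.1, h3.1.2, ?_⟩
    have h4 : L < |W ω * U ω| := h3.2
    rw [abs_mul, abs_of_nonneg h2] at h4
    by_contra! hcon
    nlinarith [abs_nonneg (U ω)]
  refine h1.trans ?_
  have hS : MeasurableSet {q : (ℝ × ℝ) × ℝ × ℝ × ℝ |
      p.1 < q.1.1 * q.2.2.1 ∧ p.2 < q.1.2 * q.2.2.2 ∧ N < |q.2.1|} := by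
    refine measurableSet_setOfPred.2 (.and (measurableSet_setOfPred.1 ?_)
      (.and (measurableSet_setOfPred.1 ?_) (measurableSet_setOfPred.1 ?_)))
    · exact measurableSet_lt measurable_const (by fun_prop)
    · exact measurableSet_lt measurable_const (by fun_prop)
    · exact measurableSet_lt measurable_const (Measurable.abs (by fun_prop))
  have hT : MeasurableSet {q : (ℝ × ℝ) × ℝ × ℝ × ℝ |
      p.1 < q.1.1 * q.2.2.1 ∧ p.2 < q.1.2 * q.2.2.2} := by
    refine measurableSet_setOfPred.2 (.and (measurableSet_setOfPred.1 ?_)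
      (measurableSet_setOfPred.1 ?_)) <;>
      exact measurableSet_lt measurable_const (by fun_prop)
  refine measureReal_le_mul_of_indepFun h.measurable_weights
    (hU.prodMk (h.measurable_left.prodMk h.measurable_right)) hind hS hT ?_
  filter_upwards [hB] with ω hω
  by_cases h0 : 0 < A ω ∧ 0 < D ω
  · have h2 := hN ((A ω)⁻¹ * p.1) ((D ω)⁻¹ * p.2)
      ((le_inv_mul_iff₀ h0.1).2 (by nlinarith [hω.1.2, hp.1]))
      ((le_inv_mul_iff₀ h0.2).2 (by nlinarith [hω.2.2, hp.2]))
    rw [← jointTail_const_mul h0.1 h0.2] at h2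
    simpa only [inv_mul_lt_iff₀ h0.1, inv_mul_lt_iff₀ h0.2] using h2
  · have h2 := jointTail_const_mul_eq_zero (μ := μ) (V := V) (Z := Z) hω.1.1 hω.2.1 h0 hp0
    refine le_trans (measureReal_mono ?_) (h2.le.trans (mul_nonneg hε.le measureReal_nonneg))
    exact fun ω' h3 => ⟨h3.1, h3.2.1⟩

lemma Model.singleJump (h : Model μ n Θ Δ X Y C) :
    SingleJump μ n (fun i ω => Θ i ω * X i ω) (fun i ω => Δ i ω * Y i ω) where
  measurable_left i hi := (h.weight_left i hi).measurable.mul (h.measurable_X i hi)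
  measurable_right i hi := (h.weight_right i hi).measurable.mul (h.measurable_Y i hi)
  shift i hi j hj l := (h.weightedPair hi hj).isEquivalent_weighted_sub l l
  scale i hi j hj s hs := (h.weightedPair hi hj).isBigO_weighted_mul hs hs
  others i hi j hj ε hε := by
    have hn : (0 : ℝ) < n := by
      exact_mod_cast (Finset.mem_Icc.1 hi).1.trans (Finset.mem_Icc.1 hi).2
    -- At most `n` competing summands in each of the two families share the total `ε`.
    have hε' : 0 < ε / (2 * n) := by positivity
    have hX : ∀ᶠ L in atTop, ∀ k ∈ (Finset.Icc 1 n).erase i, ∀ᶠ p : ℝ × ℝ in atTop ×ˢ atTop,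
        μ.real {ω | (p.1 < Θ i ω * X i ω ∧ p.2 < Δ j ω * Y j ω) ∧ L < |Θ k ω * X k ω|} ≤
          ε / (2 * n) * jointTail μ (fun ω => Θ i ω * X i ω) (fun ω => Δ j ω * Y j ω) p := by
      refine (Finset.eventually_all _).2 fun k hk => ?_
      obtain ⟨hki, hk⟩ := Finset.mem_erase.1 hk
      refine (h.weightedPair hi hj).eventually_third_le (h.measurable_X k hk) (h.weight_left k hk)
        ?_ (h.gtai.left k hk i hi hki.symm j hj) hε'
      exact h.indep_weights.comp (φ := fun w => ((w ⟨i, hi⟩).1, (w ⟨j, hj⟩).2))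
        (ψ := fun w => ((w ⟨k, hk⟩).1, (w ⟨i, hi⟩).1, (w ⟨j, hj⟩).2)) (by fun_prop) (by fun_prop)
    have hY : ∀ᶠ L in atTop, ∀ k ∈ (Finset.Icc 1 n).erase j, ∀ᶠ p : ℝ × ℝ in atTop ×ˢ atTop,
        μ.real {ω | (p.1 < Θ i ω * X i ω ∧ p.2 < Δ j ω * Y j ω) ∧ L < |Δ k ω * Y k ω|} ≤
          ε / (2 * n) * jointTail μ (fun ω => Θ i ω * X i ω) (fun ω => Δ j ω * Y j ω) p := by
      refine (Finset.eventually_all _).2 fun k hk => ?_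
      obtain ⟨hkj, hk⟩ := Finset.mem_erase.1 hk
      refine (h.weightedPair hi hj).eventually_third_le (h.measurable_Y k hk) (h.weight_right k hk)
        ?_ (h.gtai.right k hk j hj hkj i hi) hε'
      exact h.indep_weights.comp (φ := fun w => ((w ⟨i, hi⟩).1, (w ⟨j, hj⟩).2))
        (ψ := fun w => ((w ⟨k, hk⟩).2, (w ⟨i, hi⟩).1, (w ⟨j, hj⟩).2)) (by fun_prop) (by fun_prop)
    filter_upwards [hX, hY] with L h1 h2
    filter_upwards [(Finset.eventually_all _).2 h1, (Finset.eventually_all _).2 h2] with p h1 h2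
    set T := jointTail μ (fun ω => Θ i ω * X i ω) (fun ω => Δ j ω * Y j ω) p
    have hT : 0 ≤ ε / (2 * n) * T := mul_nonneg hε'.le (jointTail_nonneg _)
    have card_le : ∀ m, (((Finset.Icc 1 n).erase m).card : ℝ) ≤ n := fun m => by
      exact_mod_cast (Finset.card_erase_le).trans (by simp)
    have aux : ∀ (m : ℕ) (E : ℕ → Set Ω), (∀ k ∈ (Finset.Icc 1 n).erase m,
        μ.real ({ω | p.1 < Θ i ω * X i ω ∧ p.2 < Δ j ω * Y j ω} ∩ E k) ≤ ε / (2 * n) * T) →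
        μ.real ({ω | p.1 < Θ i ω * X i ω ∧ p.2 < Δ j ω * Y j ω} ∩
          ⋃ k ∈ (Finset.Icc 1 n).erase m, E k) ≤ ε / 2 * T := by
      intro m E hE
      rw [Set.inter_iUnion₂]
      refine (measureReal_biUnion_finset_le _ _).trans ((Finset.sum_le_card_nsmul _ _ _ hE).trans ?_)
      rw [nsmul_eq_mul]
      refine (mul_le_mul_of_nonneg_right (card_le m) hT).trans (le_of_eq ?_)
      field_simp
    rw [otherLarge, Set.inter_union_distrib_left]
    refine (measureReal_union_le _ _).trans ?_
    have h3 := aux i (fun k => {ω | L < |Θ k ω * X k ω|}) h1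
    have h4 := aux j (fun k => {ω | L < |Δ k ω * Y k ω|}) h2
    linarith

end Model

/-- Non-negativity rules out cancellation: each `g k` is at most the whole sum, so the individual
errors are little-o of it. -/
lemma isEquivalent_finset_sum {ι κ : Type*} {l : Filter ι} {s : Finset κ} {f g : κ → ι → ℝ}
    (h : ∀ k ∈ s, f k ~[l] g k) (hg : ∀ k ∈ s, ∀ p, 0 ≤ g k p) :
    (fun p => ∑ k ∈ s, f k p) ~[l] fun p => ∑ k ∈ s, g k p := by
  have h1 : (fun p => ∑ k ∈ s, (f k p - g k p)) =o[l] fun p => ∑ k ∈ s, g k p := by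
    refine IsLittleO.fun_sum fun k hk => ?_
    have hle : g k =O[l] fun p => ∑ k ∈ s, g k p := by
      refine IsBigO.of_bound 1 (Eventually.of_forall fun p => ?_)
      rw [one_mul, Real.norm_of_nonneg (hg k hk p),
        Real.norm_of_nonneg (Finset.sum_nonneg fun k hk => hg k hk p)]
      exact Finset.single_le_sum (f := fun k => g k p) (fun k hk => hg k hk p) hk
    exact (h k hk).isLittleO.trans_isBigO hle
  exact h1.congr_left fun p => by simp [Finset.sum_sub_distrib]

end BivariateRisk

/-- Asymptotics as `x ∧ y → ∞` of the ruin probability.  Here `f ~[l] g` means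
`f - g = o(g)` along `l`, i.e. `f / g → 1` wherever `g` is eventually non-zero. -/
theorem mainTheorem5 {Ω : Type*} [MeasurableSpace Ω] (μ : Measure Ω) [IsProbabilityMeasure μ]
    (n : ℕ) (hn : 1 ≤ n) (Θ Δ X Y : ℕ → Ω → ℝ) (C : ℕ → ℝ) (hM : Model μ n Θ Δ X Y C) :
    ((fun p : ℝ × ℝ => ruinProb μ Θ Δ X Y n hn p.1 p.2) ~[atTop ×ˢ atTop]
      (fun p => ∑ i ∈ Finset.Icc 1 n, ∑ j ∈ Finset.Icc 1 n,
        μ.real {ω | p.1 < Θ i ω * X i ω ∧ p.2 < Δ j ω * Y j ω})) ∧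
    (∀ α α' : ℕ → ℝ,
      (∀ i ∈ Finset.Icc 1 n, 0 ≤ α i ∧ RegularlyVarying (μ.map (X i)) (α i)) →
      (∀ j ∈ Finset.Icc 1 n, 0 ≤ α' j ∧ RegularlyVarying (μ.map (Y j)) (α' j)) →
      ((fun p : ℝ × ℝ => ruinProb μ Θ Δ X Y n hn p.1 p.2) ~[atTop ×ˢ atTop]
        (fun p => μ.real {ω | p.1 < wsum Θ X n ω ∧ p.2 < wsum Δ Y n ω})) ∧
      ((fun p : ℝ × ℝ => μ.real {ω | p.1 < wsum Θ X n ω ∧ p.2 < wsum Δ Y n ω})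
        ~[atTop ×ˢ atTop]
        (fun p =>
          (∑ i ∈ Finset.Icc 1 n, ∑ j ∈ (Finset.Icc 1 n).erase i,
            mixedMoment μ (Θ i) (Δ j) (α i) (α' j) *
              (tail (μ.map (X i)) p.1 * tail (μ.map (Y j)) p.2)) +
          ∑ i ∈ Finset.Icc 1 n,
            C i * mixedMoment μ (Θ i) (Δ i) (α i) (α' i) *
              (tail (μ.map (X i)) p.1 * tail (μ.map (Y i)) p.2)))) := by
  have hS := hM.singleJump
  have hsum : (fun p : ℝ × ℝ => μ.real {ω | p.1 < wsum Θ X n ω ∧ p.2 < wsum Δ Y n ω})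
      ~[atTop ×ˢ atTop]
      pairTailSum μ n (fun i ω => Θ i ω * X i ω) (fun i ω => Δ i ω * Y i ω) := by
    refine hS.isEquivalent_of_between (fun p => le_rfl) fun p => measureReal_mono ?_
    have hmem : n ∈ Finset.Icc 1 n := Finset.mem_Icc.2 ⟨hn, le_rfl⟩
    exact fun ω hω => ⟨⟨n, hmem, hω.1⟩, n, hmem, hω.2⟩
  have hruin : (fun p : ℝ × ℝ => ruinProb μ Θ Δ X Y n hn p.1 p.2) ~[atTop ×ˢ atTop]
      pairTailSum μ n (fun i ω => Θ i ω * X i ω) (fun i ω => Δ i ω * Y i ω) := by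
    refine hS.isEquivalent_of_between (fun p => measureReal_mono ?_) fun p => measureReal_mono ?_
    · have hmem : n ∈ Finset.Icc 1 n := Finset.mem_Icc.2 ⟨hn, le_rfl⟩
      exact fun ω hω => ⟨(Finset.lt_sup'_iff _).2 ⟨n, hmem, hω.1⟩,
        (Finset.lt_sup'_iff _).2 ⟨n, hmem, hω.2⟩⟩
    · exact fun ω hω => ⟨(Finset.lt_sup'_iff _).1 hω.1, (Finset.lt_sup'_iff _).1 hω.2⟩
  refine ⟨hruin, fun α α' hα hα' => ⟨hruin.trans hsum.symm, hsum.trans ?_⟩⟩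
  have hpair : pairTailSum μ n (fun i ω => Θ i ω * X i ω) (fun i ω => Δ i ω * Y i ω)
      ~[atTop ×ˢ atTop] fun p => ∑ i ∈ Finset.Icc 1 n, ∑ j ∈ Finset.Icc 1 n,
        (if i = j then C i else 1) * mixedMoment μ (Θ i) (Δ j) (α i) (α' j) *
          prodTail μ (X i) (Y j) p := by
    have hnonneg : ∀ i ∈ Finset.Icc 1 n, ∀ j ∈ Finset.Icc 1 n, ∀ p,
        0 ≤ (if i = j then C i else 1) * mixedMoment μ (Θ i) (Δ j) (α i) (α' j) *
          prodTail μ (X i) (Y j) p := fun i hi j hj p =>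
      mul_nonneg (mul_nonneg (hM.weightedPair hi hj).pos.le (mixedMoment_nonneg _ _ _ _))
        (prodTail_nonneg p)
    refine isEquivalent_finset_sum (fun i hi => isEquivalent_finset_sum (fun j hj => ?_)
      (hnonneg i hi)) fun i hi p => Finset.sum_nonneg fun j hj => hnonneg i hi j hj p
    exact (hM.weightedPair hi hj).isEquivalent_weighted_of_regularlyVarying (hα i hi).2 (hα' j hj).2
  refine hpair.congr_right (Eventually.of_forall fun p => ?_)
  dsimp only
  rw [← Finset.sum_add_distrib]
  refine Finset.sum_congr rfl fun i hi => ?_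
  -- The diagonal term carries `C i`; off the diagonal, independence makes the constant `1`.
  rw [← Finset.sum_erase_add _ _ hi, if_pos rfl]
  refine congrArg₂ _ (Finset.sum_congr rfl fun j hj => ?_) rfl
  rw [if_neg (Finset.ne_of_mem_erase hj).symm, one_mul, prodTail]
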